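/- Let $\mathcal X,\mathcal Y$ be finite-dimensional real inner product spaces, $\theta:\mathcal X\to(-\infty,+\infty]$ a closed proper convex function with Fenchel conjugate $\theta^*$, $\mathcal Q:\mathcal X\to\mathcal X$ a self-adjoint positive semidefinite linear operator with largest eigenvalue $\lambda_{\max}(\mathcal Q)=\max_{\|x\|=1}\langle x,\mathcal Qx\rangle$, $\mathcal A:\mathcal X\to\mathcal Y$ a linear map with adjoint $\mathcal A^*$, $c\in\mathcal X$ and $b\in\mathcal Y$. Consider the primal problem $$\min_{x\in\mathcal X}\ \theta^*(x)+\tfrac12\langle x,\mathcal Qx\rangle+\langle c,x\rangle\quad\text{s.t.}\quad \mathcal Ax=b \tag{P}$$ and its dual, in minimization form, $$\min_{w,z\in\mathcal X,\ y\in\mathcal Y}\ \tfrac12\langle w,\mathcal Qw\rangle-\langle b,y\rangle+\theta(-z)\quad\text{s.t.}\quad -\mathcal Qw+\mathcal A^*y+z=c. \tag{D}$$ For $\sigma>0$ let $$\mathcal L_\sigma(w,y,z;x)=\tfrac12\langle w,\mathcal Qw\rangle-\langle b,y\rangle+\theta(-z)+\langle \mathcal A^*y+z-\mathcal Qw-c,x\rangle+\tfrac\sigma2\|\mathcal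 A^*y+z-\mathcal Qw-c\|^2 .$$ The generalized modified ADMM with parameters $\sigma,\rho$ starts from $z^0$ with $-z^0\in\operatorname{dom}\theta$ and $x^0\in\mathcal X$ and computes, for $k=0,1,\dots$, 1. $w^{k+1}:=x^k$; 2. $y^{k+1}:=\arg\min_y\mathcal L_\sigma(w^{k+1},y,z^k;x^k)$; 3. $z^{k+1}:=\arg\min_z\{\theta(-z)+\langle z,x^k\rangle+\tfrac\sigma2\|\rho\mathcal A^*y^{k+1}-(1-\rho)z^k+z-\rho\mathcal Qw^{k+1}-\rho c\|^2\}$; 4. $x^{k+1}:=x^k+\sigma(\rho\mathcal A^*y^{k+1}-(1-\rho)z^k+z^{k+1}-\rho\mathcal Qw^{k+1}-\rho c)$. Suppose that the problem $$\min_{x\in\mathcal X}\{\theta^*(x)+\delta_{\mathcal K}(x)+\tfrac12\langle x,\mathcal Qx\rangle+\langle c,x\rangle\},\qquad \mathcal K=\{x\mid\mathcal Ax=b\},$$ where $\delta_{\mathcal K}$ is $0$ on $\mathcal K$ and $+\infty$ elsewhere, has a solution, that $\mathcal A$ is surjective, and that there is a point $x\in\operatorname{ri}(\operatorname{dom}\theta^*)$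 with $\mathcal Ax=b$. Let $\sigma\in\bigl(0,\tfrac{2}{\lambda_{\max}(\mathcal Q)}\bigr)$ (read as $(0,\infty)$ if $\lambda_{\max}(\mathcal Q)=0$) and $\rho\in\bigl(0,\tfrac{4-\sigma\lambda_{\max}(\mathcal Q)}{2}\bigr)$. Then the algorithm is well-defined: the subproblems in steps 2 (whenever $-z^k\in\operatorname{dom}\theta$) and 3 have unique solutions, and from every admissible starting point infinite sequences $\{w^k\},\{y^k\},\{z^k\},\{x^k\}$ are generated. Moreover, for all sequences so generated, $(w^k,y^k,z^k)$ converges to a solution $(w^\infty,y^\infty,z^\infty)$ of (D), $x^k$ converges to a solution $x^\infty$ of (P), and the limit solves the KKT system $$\mathcal Qw^\infty=\mathcal Qx^\infty,\quad \mathcal Ax^\infty-b=0,\quad 0\in x^\infty-\partial\theta(-z^\infty),\quad \mathcal A^*y^\infty+z^\infty-\mathcal Qw^\infty-c=0 .$$ -/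

import Mathlib

open Filter Topology

noncomputable section

namespace CQP

/-- The effective domain of an extended-real-valued function. -/
def dom {E : Type*} (f : E → EReal) : Set E := {x | f x < ⊤}

/-- Minimizers of `f` over `S`. By the usual convention of convex analysis a minimizer has value
`< +∞`, so the set is empty when `f` is identically `+∞` on `S`. -/
def argminOn {E : Type*} (f : E → EReal) (S : Set E) : Set E :=
  {x | x ∈ S ∧ f x < ⊤ ∧ ∀ x' ∈ S, f x ≤ f x'}

/-- Minimizers of `f` over the whole space. -/
def argmin {E : Type*} (f : E → EReal) : Set E := argminOn f Set.univ

open Classical in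
/-- The indicator function of a set: `0` on the set and `+∞` outside. -/
def indicator {E : Type*} (C : Set E) (x : E) : EReal := if x ∈ C then 0 else ⊤

/-- Proper: never `-∞`, and not identically `+∞`. -/
def IsProper {E : Type*} (f : E → EReal) : Prop := (∀ x, f x ≠ ⊥) ∧ (dom f).Nonempty

/-- Convexity of an extended-real-valued function: its epigraph is convex. -/
def IsConvex {E : Type*} [AddCommGroup E] [Module ℝ E] (f : E → EReal) : Prop :=
  Convex ℝ {p : E × ℝ | f p.1 ≤ (p.2 : EReal)}

/-- Closed proper convex functions (for a proper function, closed means lower semicontinuous). -/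
def IsClosedProperConvex {E : Type*} [NormedAddCommGroup E] [InnerProductSpace ℝ E]
    (f : E → EReal) : Prop :=
  LowerSemicontinuous f ∧ IsProper f ∧ IsConvex f

/-- The Fenchel conjugate `f^*(x) = sup_z (⟨x, z⟩ - f z)`. -/
def conjugate {E : Type*} [NormedAddCommGroup E] [InnerProductSpace ℝ E]
    (f : E → EReal) (x : E) : EReal :=
  ⨆ z : E, ((inner ℝ x z : ℝ) : EReal) - f z

/-- The subdifferential of `f` at `x`. -/
def subdifferential {E : Type*} [NormedAddCommGroup E] [InnerProductSpace ℝ E]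
    (f : E → EReal) (x : E) : Set E :=
  {v | ∀ x' : E, f x + ((inner ℝ v (x' - x) : ℝ) : EReal) ≤ f x'}

/-- The largest eigenvalue of a self-adjoint operator, as the maximum of `⟨x, Q x⟩` over the unit
sphere (and `0` on the zero space). -/
def lambdaMax {E : Type*} [NormedAddCommGroup E] [InnerProductSpace ℝ E]
    (Q : E →ₗ[ℝ] E) : ℝ :=
  sSup {t : ℝ | ∃ x : E, ‖x‖ = 1 ∧ t = inner ℝ x (Q x)}

/-- The quadratic function `q(x) = ⟨x, Q x⟩ / 2 + ⟨c, x⟩`. -/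
def quad {X : Type*} [NormedAddCommGroup X] [InnerProductSpace ℝ X]
    (Q : X →ₗ[ℝ] X) (c x : X) : ℝ :=
  1 / 2 * inner ℝ x (Q x) + inner ℝ c x

section Problem

variable {X Y : Type*}
  [NormedAddCommGroup X] [InnerProductSpace ℝ X] [FiniteDimensional ℝ X]
  [NormedAddCommGroup Y] [InnerProductSpace ℝ Y] [FiniteDimensional ℝ Y]

/-- Solutions of the primal problem
`min θ^*(x) + ⟨x, Q x⟩ / 2 + ⟨c, x⟩` subject to `A x = b`. -/
def primalSolutions (θ : X → EReal) (Q : X →ₗ[ℝ] X) (c : X) (A : X →ₗ[ℝ] Y) (b : Y) : Set X :=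
  argminOn (fun x => conjugate θ x + (quad Q c x : EReal)) {x | A x = b}

/-- Solutions of the unconstrained three-term problem
`min θ^*(x) + δ_K(x) + ⟨x, Q x⟩ / 2 + ⟨c, x⟩` with `K = {x | A x = b}`. -/
def threeTermSolutions (θ : X → EReal) (Q : X →ₗ[ℝ] X) (c : X) (A : X →ₗ[ℝ] Y) (b : Y) : Set X :=
  argmin (fun x => conjugate θ x + indicator {x' | A x' = b} x + (quad Q c x : EReal))

/-- Solutions `(w, y, z)` of the dual problem (in minimization form)
`min ⟨w, Q w⟩ / 2 - ⟨b, y⟩ + θ(-z)` subject to `-Q w + A^* y + z = c`. -/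
def dualSolutions (θ : X → EReal) (Q : X →ₗ[ℝ] X) (c : X) (A : X →ₗ[ℝ] Y) (b : Y) :
    Set (X × Y × X) :=
  argminOn
    (fun p => ((1 / 2 * inner ℝ p.1 (Q p.1) - inner ℝ b p.2.1 : ℝ) : EReal) + θ (-p.2.2))
    {p | -Q p.1 + LinearMap.adjoint A p.2.1 + p.2.2 = c}

/-- The KKT system for `(w, y, z, x)`. -/
def IsKKT (θ : X → EReal) (Q : X →ₗ[ℝ] X) (c : X) (A : X →ₗ[ℝ] Y) (b : Y)
    (w : X) (y : Y) (z x : X) : Prop :=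
  Q w = Q x ∧ A x - b = 0 ∧ x ∈ subdifferential θ (-z) ∧
    LinearMap.adjoint A y + z - Q w - c = 0

/-- The augmented Lagrangian `L_σ(w, y, z; x)` of the dual problem. -/
def augLagrangian (θ : X → EReal) (Q : X →ₗ[ℝ] X) (c : X) (A : X →ₗ[ℝ] Y) (b : Y) (σ : ℝ)
    (w : X) (y : Y) (z x : X) : EReal :=
  ((1 / 2 * inner ℝ w (Q w) - inner ℝ b y : ℝ) : EReal) + θ (-z)
    + ((inner ℝ (LinearMap.adjoint A y + z - Q w - c) x
        + σ / 2 * ‖LinearMap.adjoint A y + z - Q w - c‖ ^ 2 : ℝ) : EReal)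

/-- The relaxed residual `ρ A^* y - (1 - ρ) z₀ + z - ρ Q w - ρ c`, with `z₀` the previous
and `z` the new iterate. -/
def relaxedResidual (Q : X →ₗ[ℝ] X) (c : X) (A : X →ₗ[ℝ] Y) (ρ : ℝ)
    (w : X) (y : Y) (z₀ z : X) : X :=
  ρ • LinearMap.adjoint A y - (1 - ρ) • z₀ + z - ρ • Q w - ρ • c

/-- The objective, as a function of `z`, of the subproblem defining the new `z`-iterate. -/
def zObjective (θ : X → EReal) (Q : X →ₗ[ℝ] X) (c : X) (A : X →ₗ[ℝ] Y) (σ ρ : ℝ)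
    (w : X) (y : Y) (z₀ x z : X) : EReal :=
  θ (-z) + ((inner ℝ z x + σ / 2 * ‖relaxedResidual Q c A ρ w y z₀ z‖ ^ 2 : ℝ) : EReal)

/-- The sequences `w, y, z, x` are generated by the generalized modified ADMM started at
`z 0`, `x 0`. The values `w 0` and `y 0` play no role. -/
def IsGenerated (θ : X → EReal) (Q : X →ₗ[ℝ] X) (c : X) (A : X →ₗ[ℝ] Y) (b : Y) (σ ρ : ℝ)
    (w : ℕ → X) (y : ℕ → Y) (z x : ℕ → X) : Prop :=
  -z 0 ∈ dom θ ∧ ∀ k : ℕ,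
    w (k + 1) = x k ∧
    y (k + 1) ∈ argmin (fun y' => augLagrangian θ Q c A b σ (w (k + 1)) y' (z k) (x k)) ∧
    z (k + 1) ∈ argmin (zObjective θ Q c A σ ρ (w (k + 1)) (y (k + 1)) (z k) (x k)) ∧
    x (k + 1) = x k + σ • relaxedResidual Q c A ρ (w (k + 1)) (y (k + 1)) (z k) (z (k + 1))

end Problem

end CQP

end

/-! Put `s = x - σ z` and `q = quad Q c`. The method is the relaxed Davis–Yin three-operator
splitting for `θ^* + δ_K + q`. The z-step gives `x ∈ ∂θ(-z)`, that is, `x` is the proximal point of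
`σ θ^*` at `s`. The y-step makes the trial point `u` the projection of `2 x - s - σ ∇q(x)` onto `K`.
The update reads `s ↦ s + ρ (u - x)`.

Let `s'` come from a KKT point. Monotonicity of `∂θ`, orthogonality of `ker A` and `range A^*`, and
`0 ≤ Q ≤ λ_max` give, from the first iteration on, `‖s⁺ - s'‖² ≤ ‖s - s'‖² - κ ‖u - x‖²` with `κ = ρ
((4 - σ λ_max) / 2 - ρ) > 0` (`norm_add_smul_sub_sq_le`, `IsKKT.norm_sub_sq_le`). So the iterates
are bounded and `u - x → 0`; a cluster point is KKT, and Fejér monotonicity towards it gives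
convergence of the whole sequence (`IsGenerated.tendsto_isKKT`). Invertibility of `A A^*` makes `y`
a continuous function of the other iterates.

A KKT point exists (`exists_isKKT`): linearize `q` at a solution, take a multiplier for `A x = b`
(`exists_multiplier`), and invert the subgradient relation for `θ^*`. By convexity KKT points solve
both problems. -/

namespace CQP

/-! ### Extended-real arithmetic, convexity and subgradients -/

section Extended

variable {E : Type*}

lemma IsProper.exists_coe_eq {f : E → EReal} (hf : IsProper f) {x : E} (hx : f x < ⊤) :
    ∃ r : ℝ, f x = r :=
  ⟨(f x).toReal, (EReal.coe_toReal hx.ne (hf.1 x)).symm⟩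

/-- Testing against real upper bounds reduces extended-real inequalities to real ones and avoids a
case split on infinite values. -/
lemma ereal_le_of_forall_coe_le {a b : EReal} (h : ∀ r : ℝ, b ≤ r → a ≤ r) : a ≤ b := by
  induction b with
  | bot =>
    induction a with
    | bot => exact le_rfl
    | coe a =>
      have := h (a - 1) bot_le
      norm_cast at this
      linarith
    | top => exact absurd (h 0 bot_le) (by simp)
  | coe b => exact h b le_rfl
  | top => exact le_top

lemma add_coe_le_coe_iff {a : EReal} {s r : ℝ} : a + s ≤ r ↔ a ≤ ((r - s : ℝ) : EReal) := by
  induction a with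
  | bot => simp
  | coe a =>
    norm_cast
    exact le_sub_iff_add_le.symm
  | top =>
    rw [EReal.top_add_coe]
    simp only [top_le_iff, EReal.coe_ne_top]

lemma IsConvex.le_lineMap [AddCommGroup E] [Module ℝ E] {f : E → EReal} (hf : IsConvex f)
    {x y : E} {r s : ℝ} (hx : f x ≤ r) (hy : f y ≤ s) {t : ℝ} (h0 : 0 ≤ t) (h1 : t ≤ 1) :
    f (x + t • (y - x)) ≤ (((1 - t) * r + t * s : ℝ) : EReal) := by
  have h := hf (x := (x, r)) hx (y := (y, s)) hy (sub_nonneg.2 h1) h0 (by ring)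
  have e : (1 - t) • x + t • y = x + t • (y - x) := by module
  simpa [e] using h

/-- The first-order condition in one real variable. -/
lemma le_add_of_forall_small {φ r a C : ℝ}
    (h : ∀ t : ℝ, 0 < t → t ≤ 1 → φ ≤ (1 - t) * φ + t * r + (t * a + t ^ 2 * C)) :
    φ ≤ r + a := by
  have hlim : Tendsto (fun t : ℝ => r + a + t * C) (𝓝[>] 0) (𝓝 (r + a)) := by
    have : ContinuousAt (fun t : ℝ => r + a + t * C) 0 := by fun_prop
    simpa [ContinuousAt] using this.tendsto.mono_left nhdsWithin_le_nhds
  refine ge_of_tendsto hlim ?_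
  filter_upwards [Ioc_mem_nhdsGT (zero_lt_one' ℝ)] with t ht
  have h1 := h t ht.1 ht.2
  have : t * φ ≤ t * (r + a + t * C) := by linarith
  exact le_of_mul_le_mul_left this ht.1

variable [NormedAddCommGroup E] [InnerProductSpace ℝ E]

lemma mem_subdifferential_iff {f : E → EReal} {x v : E} :
    v ∈ subdifferential f x ↔
      ∀ (x' : E) (r : ℝ), f x' ≤ r → f x ≤ ((r - inner ℝ v (x' - x) : ℝ) : EReal) := by
  refine forall_congr' fun x' => ⟨fun h r hr => add_coe_le_coe_iff.1 (h.trans hr), fun h => ?_⟩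
  exact ereal_le_of_forall_coe_le fun r hr => add_coe_le_coe_iff.2 (h r hr)

lemma IsProper.lt_top_of_mem_subdifferential {f : E → EReal} (hf : IsProper f) {x v : E}
    (h : v ∈ subdifferential f x) : f x < ⊤ := by
  obtain ⟨x₀, h₀⟩ := hf.2
  obtain ⟨r, hr⟩ := hf.exists_coe_eq h₀
  exact (mem_subdifferential_iff.1 h x₀ r hr.le).trans_lt (EReal.coe_lt_top _)

lemma IsProper.subdifferential_monotone {f : E → EReal} (hf : IsProper f) {x x' v v' : E}
    (h : v ∈ subdifferential f x) (h' : v' ∈ subdifferential f x') :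
    0 ≤ inner ℝ (v - v') (x - x') := by
  obtain ⟨r, hr⟩ := hf.exists_coe_eq (hf.lt_top_of_mem_subdifferential h)
  obtain ⟨r', hr'⟩ := hf.exists_coe_eq (hf.lt_top_of_mem_subdifferential h')
  have h1 := mem_subdifferential_iff.1 h x' r' hr'.le
  have h2 := mem_subdifferential_iff.1 h' x r hr.le
  rw [hr] at h1
  rw [hr'] at h2
  norm_cast at h1 h2
  simp only [inner_sub_left, inner_sub_right] at h1 h2 ⊢
  linarith

/-- For a fixed test pair `(x', r)` the subgradient inequality places a point depending continuously
on `(u, v)` in the epigraph, which is closed. -/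
lemma mem_subdifferential_of_tendsto {f : E → EReal} (hf : LowerSemicontinuous f)
    {ι : Type*} {l : Filter ι} [l.NeBot] {u v : ι → E} {x y : E}
    (hu : Tendsto u l (𝓝 x)) (hv : Tendsto v l (𝓝 y))
    (h : ∀ᶠ i in l, v i ∈ subdifferential f (u i)) : y ∈ subdifferential f x := by
  rw [mem_subdifferential_iff]
  intro x' r hr
  have hc : Tendsto (fun i => (u i, ((r - inner ℝ (v i) (x' - u i) : ℝ) : EReal))) l
      (𝓝 (x, ((r - inner ℝ y (x' - x) : ℝ) : EReal))) := by
    refine hu.prodMk_nhds ((continuous_coe_real_ereal.tendsto _).comp ?_)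
    exact tendsto_const_nhds.sub (hv.inner (tendsto_const_nhds.sub hu))
  exact (lowerSemicontinuous_iff_isClosed_epigraph.1 hf).mem_of_tendsto hc
    (h.mono fun i hi => mem_subdifferential_iff.1 hi x' r hr)

lemma IsClosedProperConvex.comp_neg {f : E → EReal} (hf : IsClosedProperConvex f) :
    IsClosedProperConvex (fun x => f (-x)) := by
  refine ⟨hf.1.comp continuous_neg, ⟨fun x => hf.2.1.1 _, ?_⟩, ?_⟩
  · obtain ⟨x, hx⟩ := hf.2.1.2
    exact ⟨-x, by simpa [dom] using hx⟩
  · intro p hp q hq a b ha hb hab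
    have h := hf.2.2 (x := (-p.1, p.2)) hp (y := (-q.1, q.2)) hq ha hb hab
    simp only [Set.mem_ofPred_eq, Prod.fst_add, Prod.smul_fst, Prod.snd_add, Prod.smul_snd] at h ⊢
    rwa [neg_add, ← smul_neg, ← smul_neg]

end Extended

/-! ### Fenchel conjugate -/

section Conjugate

variable {E : Type*} [NormedAddCommGroup E] [InnerProductSpace ℝ E]

lemma conjugate_le_coe_iff {f : E → EReal} {x : E} {s : ℝ} :
    conjugate f x ≤ s ↔ ∀ (z : E) (r : ℝ), f z ≤ r → inner ℝ x z - r ≤ s := by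
  rw [conjugate, iSup_le_iff]
  refine forall_congr' fun z => ?_
  induction f z with
  | bot =>
    simp only [EReal.coe_sub_bot, top_le_iff, EReal.coe_ne_top, false_iff, not_forall]
    exact ⟨inner ℝ x z - s - 1, bot_le, by linarith⟩
  | coe a =>
    norm_cast
    exact ⟨fun h r hr => by linarith, fun h => h a le_rfl⟩
  | top => simp

lemma IsProper.conjugate_ne_bot {f : E → EReal} (hf : IsProper f) (x : E) :
    conjugate f x ≠ ⊥ := by
  intro h
  obtain ⟨z, hz⟩ := hf.2
  obtain ⟨r, hr⟩ := hf.exists_coe_eq hz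
  have hs : conjugate f x ≤ ((inner ℝ x z - r - 1 : ℝ) : EReal) := h.le.trans bot_le
  have := conjugate_le_coe_iff.1 hs z r hr.le
  linarith

lemma isConvex_conjugate (f : E → EReal) : IsConvex (conjugate f) := by
  intro p hp q hq a b ha hb hab
  simp only [Set.mem_ofPred_eq, Prod.fst_add, Prod.smul_fst, Prod.snd_add, Prod.smul_snd] at *
  rw [conjugate_le_coe_iff] at *
  intro z r hr
  have h1 := mul_le_mul_of_nonneg_left (hp z r hr) ha
  have h2 := mul_le_mul_of_nonneg_left (hq z r hr) hb
  simp only [inner_add_left, real_inner_smul_left, smul_eq_mul]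
  have : r = a * r + b * r := by rw [← add_mul, hab, one_mul]
  linarith

lemma conjugate_eq_of_mem_subdifferential {f : E → EReal} {x v : E}
    {r : ℝ} (hr : f x = r) (h : v ∈ subdifferential f x) :
    conjugate f v = ((inner ℝ v x - r : ℝ) : EReal) := by
  refine le_antisymm ?_ ?_
  · rw [conjugate_le_coe_iff]
    intro z s hs
    have := mem_subdifferential_iff.1 h z s hs
    rw [hr] at this
    norm_cast at this
    rw [inner_sub_right] at this
    linarith
  · refine le_trans ?_ (le_iSup _ x)
    rw [hr]
    norm_cast

end Conjugate

/-! ### Proximal subproblems and inversion of subgradients -/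

section Prox

variable {E : Type*} [NormedAddCommGroup E] [InnerProductSpace ℝ E]

/-- `h` is a quadratic function with gradient `g` and Hessian `σ` times the identity. -/
def IsIsotropicQuadratic (σ : ℝ) (h : E → ℝ) (g : E → E) : Prop :=
  ∀ q q' : E, h q' = h q + inner ℝ (g q) (q' - q) + σ / 2 * ‖q' - q‖ ^ 2

lemma IsIsotropicQuadratic.continuous {σ : ℝ} {h : E → ℝ} {g : E → E}
    (hh : IsIsotropicQuadratic σ h g) : Continuous h := by
  have : h = fun q' => h 0 + inner ℝ (g 0) (q' - 0) + σ / 2 * ‖q' - 0‖ ^ 2 :=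
    funext (hh 0)
  rw [this]
  fun_prop

variable {f : E → EReal} {σ : ℝ} {h : E → ℝ} {g : E → E}

lemma neg_gradient_mem_subdifferential_of_mem_argmin (hf : IsProper f) (hc : IsConvex f)
    (hh : IsIsotropicQuadratic σ h g) {q : E} (hq : q ∈ argmin (fun q => f q + (h q : EReal))) :
    -g q ∈ subdifferential f q := by
  obtain ⟨-, hlt, hmin⟩ := hq
  have hlt' : f q < ⊤ := by
    refine lt_top_iff_ne_top.2 fun e => ?_
    simp [e] at hlt
  obtain ⟨φ, hφ⟩ := hf.exists_coe_eq hlt'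
  rw [mem_subdifferential_iff]
  intro x r hr
  rw [hφ]
  norm_cast
  rw [inner_neg_left, sub_neg_eq_add]
  refine le_add_of_forall_small (C := σ / 2 * ‖x - q‖ ^ 2) fun t h0 h1 => ?_
  have hm := (hmin (q + t • (x - q)) trivial).trans
    (add_le_add_left (hc.le_lineMap hφ.le hr h0.le h1) _)
  simp only [hφ, hh q (q + t • (x - q))] at hm
  norm_cast at hm
  simp only [add_sub_cancel_left, inner_smul_right, norm_smul, mul_pow, Real.norm_eq_abs,
    sq_abs] at hm
  linarith

/-- The expansion of `h` at `q` is exact: its linear term cancels against the subgradient inequality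
and the quadratic term survives as a growth bound, whence uniqueness of minimizers. -/
lemma add_le_of_neg_gradient_mem_subdifferential (hf : IsProper f)
    (hh : IsIsotropicQuadratic σ h g) {q : E} (hq : -g q ∈ subdifferential f q) (q' : E) :
    f q + (h q : EReal) + ((σ / 2 * ‖q' - q‖ ^ 2 : ℝ) : EReal) ≤ f q' + (h q' : EReal) := by
  obtain ⟨φ, hφ⟩ := hf.exists_coe_eq (hf.lt_top_of_mem_subdifferential hq)
  rcases eq_or_ne (f q') ⊤ with e | e
  · simp [e]
  obtain ⟨r, hr⟩ := hf.exists_coe_eq (lt_top_iff_ne_top.2 e)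
  have := mem_subdifferential_iff.1 hq q' r hr.le
  rw [hφ] at this ⊢
  rw [hr, hh q q']
  norm_cast at *
  rw [inner_neg_left] at this
  linarith

variable [FiniteDimensional ℝ E]

/-- On the unit ball about `x₀`, `f` has a minimum `μ`. Convexity along the segment from `x₀` to
`x`, tested at unit distance, bounds the decrease of `f` by slope `m = r₀ - μ`. -/
lemma IsClosedProperConvex.exists_linear_minorant (hf : IsClosedProperConvex f) {x₀ : E} {r₀ : ℝ}
    (h₀ : f x₀ = r₀) :
    ∃ m : ℝ, 0 ≤ m ∧ ∀ (x : E) (r : ℝ), f x ≤ r → 1 ≤ ‖x - x₀‖ → r₀ - m * ‖x - x₀‖ ≤ r := by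
  have := FiniteDimensional.proper ℝ E
  obtain ⟨xm, hxm, hmin⟩ := (hf.1.lowerSemicontinuousOn (Metric.closedBall x₀ 1)).exists_isMinOn
    ⟨x₀, by simp⟩ (isCompact_closedBall x₀ 1)
  have hle : f xm ≤ r₀ := h₀ ▸ hmin (by simp)
  obtain ⟨μ, hμ⟩ := hf.2.1.exists_coe_eq (hle.trans_lt (EReal.coe_lt_top _))
  have hμ₀ : μ ≤ r₀ := by
    rw [hμ] at hle
    exact_mod_cast hle
  refine ⟨r₀ - μ, by linarith, fun x r hr hx => ?_⟩
  set d := ‖x - x₀‖ with hd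
  have hd0 : 0 < d := by linarith
  have hball : x₀ + d⁻¹ • (x - x₀) ∈ Metric.closedBall x₀ 1 := by
    rw [mem_closedBall_iff_norm, add_sub_cancel_left, norm_smul, norm_inv, norm_norm,
      inv_mul_cancel₀ hd0.ne']
  have h1 := (hmin hball).trans (hf.2.2.le_lineMap h₀.le hr (inv_nonneg.2 hd0.le)
    (inv_le_one_of_one_le₀ hx))
  simp only [hμ] at h1
  norm_cast at h1
  have h2 := mul_le_mul_of_nonneg_left h1 hd0.le
  have h3 : d * ((1 - d⁻¹) * r₀ + d⁻¹ * r) = d * r₀ - r₀ + r := by field_simp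
  linarith

/-- A closed proper convex function plus a positive multiple of the squared distance attains its
minimum. -/
lemma IsClosedProperConvex.argmin_add_quadratic_nonempty (hf : IsClosedProperConvex f)
    (hσ : 0 < σ) (hh : IsIsotropicQuadratic σ h g) :
    (argmin (fun q => f q + (h q : EReal))).Nonempty := by
  have := FiniteDimensional.proper ℝ E
  obtain ⟨x₀, hx₀⟩ := hf.2.1.2
  obtain ⟨r₀, h₀⟩ := hf.2.1.exists_coe_eq hx₀
  obtain ⟨m, hm, hmin⟩ := hf.exists_linear_minorant h₀
  -- Beyond this radius the quadratic growth dominates the linear minorant of `f` and the linear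
  -- part of `h`, so a minimizer over the ball is global.
  set R : ℝ := max 1 (2 / σ * (m + ‖g x₀‖)) with hR
  have hlsc : LowerSemicontinuous (fun q => f q + (h q : EReal)) := by
    refine hf.1.add' (continuous_coe_real_ereal.comp hh.continuous).lowerSemicontinuous fun x => ?_
    exact EReal.continuousAt_add (Or.inr (EReal.coe_ne_bot _)) (Or.inr (EReal.coe_ne_top _))
  have hx₀R : x₀ ∈ Metric.closedBall x₀ R := by
    simp only [Metric.mem_closedBall, dist_self]
    exact zero_le_one.trans (le_max_left _ _)
  obtain ⟨q, -, hq⟩ := (hlsc.lowerSemicontinuousOn (Metric.closedBall x₀ R)).exists_isMinOn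
    ⟨x₀, hx₀R⟩ (isCompact_closedBall x₀ R)
  have hq₀ : f q + (h q : EReal) ≤ ((r₀ + h x₀ : ℝ) : EReal) := by
    have := hq hx₀R
    simpa only [Set.mem_ofPred_eq, h₀, EReal.coe_add] using this
  refine ⟨q, trivial, hq₀.trans_lt (EReal.coe_lt_top _), fun x _ => ?_⟩
  by_cases hx : x ∈ Metric.closedBall x₀ R
  · exact hq hx
  refine hq₀.trans ?_
  rcases eq_or_ne (f x) ⊤ with e | e
  · simp [e]
  obtain ⟨r, hr⟩ := hf.2.1.exists_coe_eq (lt_top_iff_ne_top.2 e)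
  simp only [hr]
  norm_cast
  rw [mem_closedBall_iff_norm, not_le] at hx
  have h1 : 1 < ‖x - x₀‖ := (le_max_left _ _).trans_lt hx
  have h2 : 2 / σ * (m + ‖g x₀‖) < ‖x - x₀‖ := (le_max_right _ _).trans_lt hx
  have h3 := hmin x r hr.le h1.le
  have h4 := abs_le.1 (abs_real_inner_le_norm (g x₀) (x - x₀))
  have h5 : m + ‖g x₀‖ ≤ σ / 2 * ‖x - x₀‖ := by
    have := mul_le_mul_of_nonneg_left h2.le (half_pos hσ).le
    rwa [← mul_assoc, show σ / 2 * (2 / σ) = 1 by field_simp, one_mul] at this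
  rw [hh x₀ x]
  nlinarith [mul_le_mul_of_nonneg_right h5 (norm_nonneg (x - x₀)), h4.1]

lemma IsClosedProperConvex.existsUnique_mem_argmin_add_quadratic (hf : IsClosedProperConvex f)
    (hσ : 0 < σ) (hh : IsIsotropicQuadratic σ h g) :
    ∃! q, q ∈ argmin (fun q => f q + (h q : EReal)) := by
  obtain ⟨q, hq⟩ := hf.argmin_add_quadratic_nonempty hσ hh
  refine ⟨q, hq, fun q' hq' => ?_⟩
  have h1 := add_le_of_neg_gradient_mem_subdifferential hf.2.1 hh
    (neg_gradient_mem_subdifferential_of_mem_argmin hf.2.1 hf.2.2 hh hq) q'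
  have h2 := h1.trans (hq'.2.2 q trivial)
  have hlt : f q < ⊤ := by
    refine lt_top_iff_ne_top.2 fun e => ?_
    have := hq.2.1
    simp [e] at this
  obtain ⟨r, hr⟩ := hf.2.1.exists_coe_eq hlt
  simp only [hr] at h2
  norm_cast at h2
  have h3 : ‖q' - q‖ ^ 2 ≤ 0 := by
    by_contra hne
    have := mul_pos (half_pos hσ) (not_le.1 hne)
    linarith
  exact sub_eq_zero.1 (norm_eq_zero.1 (pow_eq_zero_iff two_ne_zero |>.1
    (le_antisymm h3 (sq_nonneg _))))

/-- Subgradients of the conjugate are inverse subgradients of the function. -/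
lemma IsClosedProperConvex.mem_subdifferential_of_conjugate (hf : IsClosedProperConvex f)
    {x p : E} {φ : ℝ} (hφ : conjugate f x = φ)
    (hp : p ∈ subdifferential (conjugate f) x) : x ∈ subdifferential f p := by
  -- The proximal point `q` of `p + x` satisfies `v = p + x - q ∈ ∂f(q)`; it remains to show `q =
  -- p`.
  have hquad : IsIsotropicQuadratic 1 (fun q => 1 / 2 * ‖q - (p + x)‖ ^ 2)
      (fun q => q - (p + x)) := by
    intro q q'
    have e : q' - (p + x) = (q - (p + x)) + (q' - q) := by abel
    simp only [e, norm_add_sq_real]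
    ring
  obtain ⟨q, hq⟩ := hf.argmin_add_quadratic_nonempty one_pos hquad
  have hsub := neg_gradient_mem_subdifferential_of_mem_argmin hf.2.1 hf.2.2 hquad hq
  set v := -(q - (p + x)) with hv
  obtain ⟨r, hr⟩ := hf.2.1.exists_coe_eq (hf.2.1.lt_top_of_mem_subdifferential hsub)
  have hcv := conjugate_eq_of_mem_subdifferential hr hsub
  have h1 := mem_subdifferential_iff.1 hp v _ hcv.le
  have h2 := conjugate_le_coe_iff.1 hφ.le q r hr.le
  rw [hφ] at h1
  norm_cast at h1
  -- Adding the Fenchel equality at `(q, v)`, Fenchel–Young at `(q, x)` and the inequality for `p`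
  -- gives `0 ≤ ⟨v - x, q - p⟩`, and `v - x = p - q`.
  have h3 : ‖q - p‖ ^ 2 ≤ 0 := by
    have e : inner ℝ v q - inner ℝ x q - inner ℝ p (v - x) = -‖q - p‖ ^ 2 := by
      rw [← inner_sub_left, show v - x = p - q by rw [hv]; abel, real_inner_comm,
        ← inner_sub_left, ← real_inner_self_eq_norm_sq, ← inner_neg_right, neg_sub]
    linarith
  have h4 : q = p := sub_eq_zero.1 (norm_eq_zero.1 (pow_eq_zero_iff two_ne_zero |>.1
    (le_antisymm h3 (sq_nonneg _))))
  have h5 : v = x := by rw [hv, h4]; abel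
  rwa [h5, h4] at hsub

end Prox

/-! ### Lagrange multipliers by M. Riesz extension -/

section Multiplier

variable {X Y : Type*}
  [NormedAddCommGroup X] [InnerProductSpace ℝ X]
  [NormedAddCommGroup Y] [InnerProductSpace ℝ Y] [FiniteDimensional ℝ Y]

lemma exists_pos_add_smul_mem_of_mem_intrinsicInterior {s : Set X} {x₀ l : X}
    (h₀ : x₀ ∈ intrinsicInterior ℝ s) (hl : l ∈ (affineSpan ℝ s).direction) :
    ∃ ε : ℝ, 0 < ε ∧ x₀ + ε • l ∈ s := by
  obtain ⟨p, hp, rfl⟩ := mem_intrinsicInterior.1 h₀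
  have hmem : ∀ t : ℝ, (p : X) + t • l ∈ affineSpan ℝ s := fun t => by
    rw [add_comm]
    exact AffineSubspace.vadd_mem_of_mem_direction (Submodule.smul_mem _ t hl) p.2
  have hcont : Continuous fun t : ℝ => (⟨(p : X) + t • l, hmem t⟩ : affineSpan ℝ s) := by
    fun_prop
  have hnhds : ∀ᶠ t : ℝ in 𝓝[>] 0, (⟨(p : X) + t • l, hmem t⟩ : affineSpan ℝ s) ∈
      interior ((↑) ⁻¹' s : Set (affineSpan ℝ s)) := by
    refine (hcont.tendsto 0).mono_left nhdsWithin_le_nhds |>.eventually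
      (isOpen_interior.mem_nhds ?_)
    convert hp using 1
    exact Subtype.ext (by simp)
  obtain ⟨t, ht, ht0⟩ := (hnhds.and self_mem_nhdsWithin).exists
  exact ⟨t, ht0, (interior_subset ht : _ ∈ ((↑) ⁻¹' s : Set (affineSpan ℝ s)))⟩

/-- The cone generated by the values of the constraint and of the linearized objective. -/
def perturbationCone {f : X → EReal} (hc : IsConvex f) (hn : (dom f).Nonempty)
    (A : X →ₗ[ℝ] Y) (b : Y) (g : X) (a : ℝ) : PointedCone ℝ (Y × ℝ) where
  carrier := {p | ∃ (μ : ℝ) (x : X) (r : ℝ), 0 ≤ μ ∧ f x ≤ r ∧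
    p = (μ • (A x - b), μ * (r + inner ℝ g x - a))}
  zero_mem' := by
    obtain ⟨x, hx⟩ := hn
    obtain ⟨r, hr, -⟩ := EReal.lt_iff_exists_real_btwn.1 hx
    exact ⟨0, x, r, le_rfl, hr.le, by simp [Prod.ext_iff]⟩
  add_mem' := by
    rintro _ _ ⟨μ, x, r, hμ, hr, rfl⟩ ⟨ν, y, s, hν, hs, rfl⟩
    rcases (add_nonneg hμ hν).eq_or_lt with h | h
    · obtain rfl : μ = 0 := by linarith
      obtain rfl : ν = 0 := by linarith
      exact ⟨0, x, r, le_rfl, hr, by simp⟩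
    · refine ⟨μ + ν, x + (ν / (μ + ν)) • (y - x), _, h.le,
        hc.le_lineMap hr hs (by positivity) ((div_le_one h).2 (by linarith)), ?_⟩
      have e : (μ + ν) * (ν / (μ + ν)) = ν := by field_simp
      refine Prod.ext ?_ ?_
      · simp only [Prod.fst_add, map_add, map_smul, map_sub, add_sub_right_comm _ _ b]
        rw [smul_add, smul_smul, e]
        module
      · simp only [Prod.snd_add, inner_add_right, inner_smul_right, inner_sub_right]
        linear_combination (r - s + inner ℝ g x - inner ℝ g y) * e
  smul_mem' := by
    rintro c _ ⟨μ, x, r, hμ, hr, rfl⟩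
    refine ⟨c * μ, x, r, mul_nonneg c.2 hμ, hr, Prod.ext ?_ ?_⟩
    · simp [mul_smul]
    · exact (mul_assoc (c : ℝ) _ _).symm

/-- Existence of a Lagrange multiplier for linear constraints under the relative interior
constraint qualification. -/
lemma exists_multiplier {f : X → EReal} (hf : IsProper f) (hc : IsConvex f)
    (A : X →ₗ[ℝ] Y) (b : Y) (g : X) (a : ℝ)
    (hmin : ∀ (x : X) (r : ℝ), A x = b → f x ≤ r → a ≤ r + inner ℝ g x)
    (hri : ∃ x ∈ intrinsicInterior ℝ (dom f), A x = b) :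
    ∃ y : Y, ∀ (x : X) (r : ℝ), f x ≤ r → a + inner ℝ y (A x - b) ≤ r + inner ℝ g x := by
  obtain ⟨x₀, h₀, hA₀⟩ := hri
  -- All constraint values `A x - b` with `x ∈ dom f` lie in `V`. The functional `(v, t) ↦ t` on `W
  -- × ℝ` is therefore tested only at feasible points, since `V ∩ W = 0`.
  set V : Submodule ℝ Y := (affineSpan ℝ (dom f)).direction.map A with hV
  obtain ⟨W, hW⟩ := V.exists_isCompl
  have hmemV : ∀ x ∈ dom f, A x - b ∈ V := fun x hx => by
    refine ⟨x - x₀, AffineSubspace.vsub_mem_direction (mem_affineSpan ℝ hx)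
      (mem_affineSpan ℝ (intrinsicInterior_subset h₀)), ?_⟩
    rw [map_sub, hA₀]
  let F : (Y × ℝ) →ₗ.[ℝ] ℝ := ⟨W.prod ⊤, (LinearMap.snd ℝ Y ℝ).comp (W.prod ⊤).subtype⟩
  have hnonneg : ∀ p : F.domain, (p : Y × ℝ) ∈ perturbationCone hc hf.2 A b g a → 0 ≤ F p := by
    rintro ⟨p, hp⟩ ⟨μ, x, r, hμ, hr, rfl⟩
    change 0 ≤ μ * (r + inner ℝ g x - a)
    rcases hμ.eq_or_lt with rfl | hμ'
    · simp
    have hx := hmemV x (hr.trans_lt (EReal.coe_lt_top _))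
    have h0 : μ • (A x - b) = 0 :=
      Submodule.disjoint_def.1 hW.disjoint _ (V.smul_mem _ hx) hp.1
    have hAx : A x = b := sub_eq_zero.1 ((smul_eq_zero.1 h0).resolve_left hμ'.ne')
    have := hmin x r hAx hr
    exact mul_nonneg hμ (by linarith)
  have hdense : ∀ p : Y × ℝ, ∃ q : F.domain, (q : Y × ℝ) + p ∈
      perturbationCone hc hf.2 A b g a := by
    rintro ⟨v, t⟩
    obtain ⟨_, ⟨l, hl, rfl⟩, w, hw, hvw⟩ :=
      Submodule.mem_sup.1 (hW.sup_eq_top.symm ▸ Submodule.mem_top : v ∈ V ⊔ W)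
    -- Relative interiority makes a small step from `x₀` along `l` stay in the domain; rescaling by
    -- `ε⁻¹` yields constraint value `A l`, while `W × ℝ` absorbs the rest.
    obtain ⟨ε, hε, hd⟩ := exists_pos_add_smul_mem_of_mem_intrinsicInterior h₀ hl
    obtain ⟨r, hr⟩ := hf.exists_coe_eq hd
    refine ⟨⟨(-w, ε⁻¹ * (r + inner ℝ g (x₀ + ε • l) - a) - t), ⟨W.neg_mem hw, trivial⟩⟩,
      ε⁻¹, x₀ + ε • l, r, (inv_pos.2 hε).le, hr.le, Prod.ext ?_ ?_⟩
    · simp only [Prod.fst_add, ← hvw, map_add, map_smul, hA₀, add_sub_cancel_left, smul_smul,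
        inv_mul_cancel₀ hε.ne', one_smul]
      abel
    · simp
  obtain ⟨G, hGF, hG⟩ := riesz_extension _ F hnonneg hdense
  have hG1 : G (0, 1) = 1 := hGF ⟨(0, 1), ⟨W.zero_mem, trivial⟩⟩
  let η : Y →ₗ[ℝ] ℝ := G.comp (LinearMap.inl ℝ Y ℝ)
  -- Nonnegativity of `G` on the cone reads `0 ≤ η (A x - b) + (r + ⟨g, x⟩ - a)`, so the multiplier
  -- represents `-η`.
  refine ⟨-(InnerProductSpace.toDual ℝ Y).symm (LinearMap.toContinuousLinearMap η),
    fun x r hr => ?_⟩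
  have h1 := hG _ (⟨1, x, r, zero_le_one, hr, rfl⟩ :
    _ ∈ perturbationCone hc hf.2 A b g a)
  have e : ((1 : ℝ) • (A x - b), 1 * (r + inner ℝ g x - a)) =
      (A x - b, (0 : ℝ)) + (r + inner ℝ g x - a) • ((0 : Y), (1 : ℝ)) := by simp
  rw [e, map_add, map_smul, hG1] at h1
  have h2 : inner ℝ ((InnerProductSpace.toDual ℝ Y).symm (LinearMap.toContinuousLinearMap η))
      (A x - b) = G (A x - b, 0) := by
    rw [InnerProductSpace.toDual_symm_apply]
    rfl
  rw [inner_neg_left, h2]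
  simp only [smul_eq_mul, mul_one] at h1
  linarith

end Multiplier

/-! ### KKT points: existence and optimality -/

lemma quad_add {X : Type*} [NormedAddCommGroup X] [InnerProductSpace ℝ X] {Q : X →ₗ[ℝ] X} {c : X}
    (hQ : Q.IsPositive) (x d : X) :
    quad Q c (x + d) = quad Q c x + inner ℝ (Q x + c) d + 1 / 2 * inner ℝ d (Q d) := by
  have h : inner ℝ x (Q d) = inner ℝ (Q x) d := (hQ.isSymmetric x d).symm
  have h' : inner ℝ d (Q x) = inner ℝ (Q x) d := real_inner_comm _ _
  simp only [quad, map_add, inner_add_left, inner_add_right, h, h']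
  ring

section KKT

variable {X Y : Type*}
  [NormedAddCommGroup X] [InnerProductSpace ℝ X] [FiniteDimensional ℝ X]
  [NormedAddCommGroup Y] [InnerProductSpace ℝ Y] [FiniteDimensional ℝ Y]
  {θ : X → EReal} {Q : X →ₗ[ℝ] X} {c : X} {A : X →ₗ[ℝ] Y} {b : Y}

lemma exists_isKKT (hθ : IsClosedProperConvex θ) (hQ : Q.IsPositive)
    (hsol : (threeTermSolutions θ Q c A b).Nonempty)
    (hri : ∃ x ∈ intrinsicInterior ℝ (dom (conjugate θ)), A x = b) :
    ∃ (y : Y) (z x : X), IsKKT θ Q c A b x y z x := by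
  obtain ⟨x, -, hlt, hmin⟩ := hsol
  have hbot := hθ.2.1.conjugate_ne_bot
  have hAx : A x = b := by
    by_contra hne
    simp [indicator, hne, EReal.add_top_of_ne_bot (hbot x)] at hlt
  have hind : ∀ x' : X, A x' = b → indicator {x' | A x' = b} x' = 0 := fun x' h => if_pos h
  have hproper : IsProper (conjugate θ) := by
    obtain ⟨x₀, h₀, -⟩ := hri
    exact ⟨hbot, x₀, intrinsicInterior_subset h₀⟩
  have hx : conjugate θ x < ⊤ := by
    refine lt_top_iff_ne_top.2 fun e => ?_
    simp [hind x hAx, e] at hlt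
  obtain ⟨φ, hφ⟩ := hproper.exists_coe_eq hx
  have hlin : ∀ (x' : X) (r : ℝ), A x' = b → conjugate θ x' ≤ r →
      φ + inner ℝ (Q x + c) x ≤ r + inner ℝ (Q x + c) x' := fun x' r hAx' hr => by
    -- The minimizer also minimizes the problem with `q` linearized at `x`: along a feasible segment
    -- the quadratic remainder is of order `t²`.
    have key : φ ≤ r + inner ℝ (Q x + c) (x' - x) := by
      refine le_add_of_forall_small (C := 1 / 2 * inner ℝ (x' - x) (Q (x' - x)))
        fun t h0 h1 => ?_
      have hA' : A (x + t • (x' - x)) = b := by simp [hAx, hAx']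
      have hm := hmin (x + t • (x' - x)) trivial
      simp only [hind _ hAx, hind _ hA', hφ, add_zero] at hm
      have hm' := hm.trans (add_le_add_left
        ((isConvex_conjugate θ).le_lineMap hφ.le hr h0.le h1) _)
      norm_cast at hm'
      rw [quad_add hQ] at hm'
      simp only [map_smul, inner_smul_left, inner_smul_right, RCLike.conj_to_real] at hm'
      linarith
    rw [inner_sub_right] at key
    linarith
  obtain ⟨y, hy⟩ := exists_multiplier hproper (isConvex_conjugate θ) A b (Q x + c) _ hlin hri
  -- Dual feasibility with `w = x` forces this `z`; the multiplier inequality says `-z ∈ ∂θ^*(x)`.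
  refine ⟨y, Q x + c - LinearMap.adjoint A y, x, rfl, sub_eq_zero.2 hAx, ?_, by abel⟩
  refine hθ.mem_subdifferential_of_conjugate hφ ?_
  rw [mem_subdifferential_iff]
  intro x' r hr
  have h := hy x' r hr
  rw [hφ]
  norm_cast
  rw [← hAx, ← map_sub, ← LinearMap.adjoint_inner_left] at h
  simp only [neg_sub, inner_sub_left, inner_add_left, inner_sub_right] at h ⊢
  linarith

/-- Fenchel–Young at `-z` and convexity of `q` leave the linear term `⟨Q x + c - z, x' - x⟩ = ⟨y, A
(x' - x)⟩`, which vanishes for feasible `x'`. -/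
lemma IsKKT.mem_primalSolutions (hθ : IsProper θ) (hQ : Q.IsPositive) {w z x : X} {y : Y}
    (h : IsKKT θ Q c A b w y z x) : x ∈ primalSolutions θ Q c A b := by
  obtain ⟨hw, hAx, hsub, hd⟩ := h
  rw [sub_eq_zero] at hAx
  obtain ⟨r, hr⟩ := hθ.exists_coe_eq (hθ.lt_top_of_mem_subdifferential hsub)
  have hconj := conjugate_eq_of_mem_subdifferential hr hsub
  refine ⟨hAx, ?_, fun x' hx' => ereal_le_of_forall_coe_le fun s hs => ?_⟩
  · simp only [hconj]
    norm_cast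
    exact EReal.coe_lt_top _
  · simp only [hconj]
    rw [add_coe_le_coe_iff] at hs
    have h1 := conjugate_le_coe_iff.1 hs (-z) r hr.le
    have h2 := quad_add (c := c) hQ x (x' - x)
    rw [add_sub_cancel] at h2
    have h3 := hQ.inner_nonneg_right (x' - x)
    have h4 : inner ℝ (Q x + c) (x' - x) = inner ℝ z (x' - x) := by
      have e : Q x + c = LinearMap.adjoint A y + z := by
        rw [← hw, ← sub_eq_zero, ← neg_eq_zero, ← hd]
        abel
      have hx'' : A x' = b := hx'
      rw [e, inner_add_left, LinearMap.adjoint_inner_left, map_sub, hAx, hx'', sub_self,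
        inner_zero_right, zero_add]
    norm_cast
    simp only [inner_neg_right, inner_sub_right] at h1 h4 ⊢
    rw [inner_sub_right (Q x + c)] at h2
    linarith [real_inner_comm x' z, real_inner_comm x z]

/-- Here `x` is the multiplier of the dual constraint: the constraint expresses `z' - z` through `y'
- y` and `w' - w`, and the linear terms cancel by `A x = b` and `Q w = Q x`. -/
lemma IsKKT.mem_dualSolutions (hθ : IsProper θ) (hQ : Q.IsPositive) {w z x : X} {y : Y}
    (h : IsKKT θ Q c A b w y z x) : (w, y, z) ∈ dualSolutions θ Q c A b := by
  obtain ⟨hw, hAx, hsub, hd⟩ := h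
  rw [sub_eq_zero] at hAx
  obtain ⟨r, hr⟩ := hθ.exists_coe_eq (hθ.lt_top_of_mem_subdifferential hsub)
  refine ⟨?_, ?_, ?_⟩
  · change -Q w + LinearMap.adjoint A y + z = c
    rw [← sub_eq_zero, ← hd]
    abel
  · simp only [hr]
    norm_cast
    exact EReal.coe_lt_top _
  · rintro ⟨w', y', z'⟩ hp
    change -Q w' + LinearMap.adjoint A y' + z' = c at hp
    refine ereal_le_of_forall_coe_le fun s hs => ?_
    simp only [hr] at hs ⊢
    rw [add_comm, add_coe_le_coe_iff] at hs
    have h1 := mem_subdifferential_iff.1 hsub _ _ hs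
    rw [hr] at h1
    norm_cast at h1 ⊢
    have h2 := hQ.inner_nonneg_right (w' - w)
    have h3 : inner ℝ w (Q w') = inner ℝ (Q w) w' := (hQ.isSymmetric w w').symm
    have e : -z' - -z = LinearMap.adjoint A (y' - y) - Q (w' - w) := by
      rw [map_sub, map_sub]
      have hd' : z = c + Q w - LinearMap.adjoint A y := by
        rw [← sub_eq_zero, ← hd]
        abel
      rw [← hp] at hd'
      rw [hd']
      abel
    have h4 : inner ℝ x (Q (w' - w)) = inner ℝ (Q w) (w' - w) := by
      rw [← hQ.isSymmetric, hw]
    rw [e, inner_sub_right, LinearMap.adjoint_inner_right, hAx, h4] at h1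
    simp only [map_sub, inner_sub_left, inner_sub_right, h3] at h1 h2 ⊢
    linarith [real_inner_comm w' (Q w), real_inner_comm w (Q w)]

end KKT

/-! ### Subproblems, well-definedness and the one-step estimate -/

section Inner

variable {X : Type*} [NormedAddCommGroup X] [InnerProductSpace ℝ X]

lemma neg_mem_subdifferential_comp_neg_iff {θ : X → EReal} {x z : X} :
    -x ∈ subdifferential (fun z => θ (-z)) z ↔ x ∈ subdifferential θ (-z) := by
  refine (Equiv.neg X).forall_congr fun {z'} => ?_
  have : inner ℝ (-x) (z' - z) = inner ℝ x (-z' - -z) := by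
    rw [inner_neg_left, ← inner_neg_right]
    congr 1
    abel
  simp only [this, Equiv.neg_apply]

lemma norm_le_of_inner_sub_nonneg {a d : X} (had : 0 ≤ inner ℝ a (d - a)) : ‖a‖ ≤ ‖d‖ := by
  rw [inner_sub_right, real_inner_self_eq_norm_sq] at had
  have := real_inner_le_norm a d
  by_contra! h
  nlinarith [norm_nonneg a, norm_nonneg d]

end Inner

section Algorithm

variable {X Y : Type*}
  [NormedAddCommGroup X] [InnerProductSpace ℝ X] [FiniteDimensional ℝ X]
  [NormedAddCommGroup Y] [InnerProductSpace ℝ Y] [FiniteDimensional ℝ Y]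
  {θ : X → EReal} {Q : X →ₗ[ℝ] X} {c : X} {A : X →ₗ[ℝ] Y} {b : Y} {σ ρ : ℝ}

lemma inner_le_lambdaMax (Q : X →ₗ[ℝ] X) (x : X) :
    inner ℝ x (Q x) ≤ lambdaMax Q * ‖x‖ ^ 2 := by
  rcases eq_or_ne x 0 with rfl | hx
  · simp
  have hn : 0 < ‖x‖ := norm_pos_iff.2 hx
  have hbdd : BddAbove {t : ℝ | ∃ x : X, ‖x‖ = 1 ∧ t = inner ℝ x (Q x)} := by
    refine ⟨‖LinearMap.toContinuousLinearMap Q‖, ?_⟩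
    rintro _ ⟨v, hv, rfl⟩
    have h1 := (real_inner_le_norm v (Q v)).trans
      (mul_le_mul_of_nonneg_left ((LinearMap.toContinuousLinearMap Q).le_opNorm v)
        (norm_nonneg v))
    simpa [hv] using h1
  have h := le_csSup hbdd ⟨‖x‖⁻¹ • x, by
    rw [norm_smul, norm_inv, norm_norm, inv_mul_cancel₀ hn.ne'], rfl⟩
  rw [map_smul, real_inner_smul_left, real_inner_smul_right] at h
  change _ ≤ lambdaMax Q at h
  have h2 := mul_le_mul_of_nonneg_right h (sq_nonneg ‖x‖)
  have e : ‖x‖⁻¹ * (‖x‖⁻¹ * inner ℝ x (Q x)) * ‖x‖ ^ 2 = inner ℝ x (Q x) := by field_simp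
  rwa [e] at h2

/-- The Gram operator of a surjective map is invertible. -/
lemma exists_gram_inverse (hA : Function.Surjective A) :
    ∃ G : Y →ₗ[ℝ] Y, ∀ y v : Y, A (LinearMap.adjoint A y) = v ↔ y = G v := by
  have hinj : Function.Injective (A ∘ₗ LinearMap.adjoint A) := by
    refine (injective_iff_map_eq_zero _).2 fun y hy => ?_
    have h1 : inner ℝ (LinearMap.adjoint A y) (LinearMap.adjoint A y) = (0 : ℝ) := by
      rw [LinearMap.adjoint_inner_left]
      change inner ℝ y ((A ∘ₗ LinearMap.adjoint A) y) = (0 : ℝ)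
      rw [hy, inner_zero_right]
    obtain ⟨x, hx⟩ := hA y
    rw [← inner_self_eq_zero (𝕜 := ℝ)]
    nth_rewrite 2 [← hx]
    rw [← LinearMap.adjoint_inner_left, inner_self_eq_zero.1 h1, inner_zero_left]
  let e := LinearEquiv.ofInjectiveEndo _ hinj
  refine ⟨e.symm, fun y v => ?_⟩
  exact (e.eq_symm_apply).symm

/-- The trial point `x + σ (A^* y + z - Q w - c)`. -/
noncomputable def trialPoint (Q : X →ₗ[ℝ] X) (c : X) (A : X →ₗ[ℝ] Y) (σ : ℝ) (w : X) (y : Y) (z x : X) : X :=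
  x + σ • (LinearMap.adjoint A y + z - Q w - c)

/-- In `y` the augmented Lagrangian is a convex quadratic with gradient `A u - b`, where `u` is the
trial point. -/
lemma mem_argmin_augLagrangian_iff (hθ : IsProper θ) (hσ : 0 < σ) {w z x : X}
    (hz : -z ∈ dom θ) {y : Y} :
    y ∈ argmin (fun y' => augLagrangian θ Q c A b σ w y' z x) ↔
      A (trialPoint Q c A σ w y z x) = b := by
  obtain ⟨r, hr⟩ := hθ.exists_coe_eq hz
  set H : Y → ℝ := fun y' => 1 / 2 * inner ℝ w (Q w) - inner ℝ b y' + r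
    + (inner ℝ (LinearMap.adjoint A y' + z - Q w - c) x
        + σ / 2 * ‖LinearMap.adjoint A y' + z - Q w - c‖ ^ 2) with hH
  have hL : (fun y' => augLagrangian θ Q c A b σ w y' z x) = fun y' => (H y' : EReal) := by
    funext y'
    simp only [augLagrangian, hr, hH]
    norm_cast
  have hexp : ∀ d : Y, H (y + d) = H y + inner ℝ (A (trialPoint Q c A σ w y z x) - b) d
      + σ / 2 * ‖LinearMap.adjoint A d‖ ^ 2 := fun d => by
    have e : LinearMap.adjoint A (y + d) + z - Q w - c =
        (LinearMap.adjoint A y + z - Q w - c) + LinearMap.adjoint A d := by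
      rw [map_add]
      abel
    simp only [hH, e, inner_add_right, inner_add_left _ (LinearMap.adjoint A d),
      norm_add_sq_real, inner_sub_left (A _) b, trialPoint]
    rw [← LinearMap.adjoint_inner_right A _ d, inner_add_left x, real_inner_smul_left,
      real_inner_comm x (LinearMap.adjoint A d)]
    ring
  rw [hL]
  constructor
  · rintro ⟨-, -, hmin⟩
    set v := A (trialPoint Q c A σ w y z x) - b with hv
    have key : (0 : ℝ) ≤ 0 + -‖v‖ ^ 2 := by
      refine le_add_of_forall_small (C := σ / 2 * ‖LinearMap.adjoint A v‖ ^ 2)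
        fun t _ _ => ?_
      have h1 : H y ≤ H (y + -(t • v)) := EReal.coe_le_coe_iff.1 (hmin _ trivial)
      rw [hexp, map_neg, norm_neg, map_smul, norm_smul, inner_neg_right, real_inner_smul_right,
        real_inner_self_eq_norm_sq, mul_pow, Real.norm_eq_abs, sq_abs] at h1
      linarith
    have h2 : ‖v‖ ^ 2 = 0 := le_antisymm (by linarith) (sq_nonneg _)
    exact sub_eq_zero.1 (norm_eq_zero.1 (pow_eq_zero_iff two_ne_zero |>.1 h2))
  · intro h
    refine ⟨trivial, EReal.coe_lt_top _, fun y' _ => ?_⟩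
    have h1 := hexp (y' - y)
    rw [h, sub_self, inner_zero_left, add_sub_cancel] at h1
    refine EReal.coe_le_coe_iff.2 ?_
    rw [h1]
    have : 0 ≤ σ / 2 * ‖LinearMap.adjoint A (y' - y)‖ ^ 2 := by positivity
    linarith

/-- Solving for `y` gives uniqueness of the y-step and, later, its continuous dependence on `(x,
z)`. -/
lemma map_trialPoint_eq_iff (hσ : 0 < σ) {G : Y →ₗ[ℝ] Y}
    (hG : ∀ y v : Y, A (LinearMap.adjoint A y) = v ↔ y = G v) {w z x : X} {y : Y} :
    A (trialPoint Q c A σ w y z x) = b ↔ y = G (σ⁻¹ • (b - A x) - A (z - Q w - c)) := by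
  have e : trialPoint Q c A σ w y z x =
      x + σ • (LinearMap.adjoint A y + (z - Q w - c)) := by
    rw [trialPoint]
    congr 2
    abel
  rw [← hG, e, map_add, map_smul, map_add, eq_sub_iff_add_eq, eq_inv_smul_iff₀ hσ.ne',
    eq_sub_iff_add_eq, add_comm]

lemma existsUnique_mem_argmin_augLagrangian (hθ : IsProper θ) (hA : Function.Surjective A)
    (hσ : 0 < σ) (w z x : X) (hz : -z ∈ dom θ) :
    ∃! y : Y, y ∈ argmin (fun y' => augLagrangian θ Q c A b σ w y' z x) := by
  obtain ⟨G, hG⟩ := exists_gram_inverse hA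
  simp only [mem_argmin_augLagrangian_iff hθ hσ hz, map_trialPoint_eq_iff hσ hG]
  exact existsUnique_eq

lemma isIsotropicQuadratic_zObjective (Q : X →ₗ[ℝ] X) (c : X) (A : X →ₗ[ℝ] Y) (σ ρ : ℝ)
    (w : X) (y : Y) (z₀ x : X) :
    IsIsotropicQuadratic σ
      (fun z => inner ℝ z x + σ / 2 * ‖relaxedResidual Q c A ρ w y z₀ z‖ ^ 2)
      (fun z => x + σ • relaxedResidual Q c A ρ w y z₀ z) := by
  intro q q'
  have e : relaxedResidual Q c A ρ w y z₀ q' =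
      relaxedResidual Q c A ρ w y z₀ q + (q' - q) := by
    simp only [relaxedResidual]
    abel
  simp only [e, norm_add_sq_real, inner_add_left x, real_inner_smul_left, inner_sub_right x,
    real_inner_comm x]
  ring

lemma IsClosedProperConvex.existsUnique_mem_argmin_zObjective (hθ : IsClosedProperConvex θ)
    (hσ : 0 < σ) (w : X) (y : Y) (z₀ x : X) :
    ∃! z : X, z ∈ argmin (zObjective θ Q c A σ ρ w y z₀ x) :=
  hθ.comp_neg.existsUnique_mem_argmin_add_quadratic hσ
    (isIsotropicQuadratic_zObjective Q c A σ ρ w y z₀ x)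

/-- The gradient of the quadratic part of the z-subproblem at its minimizer is exactly the next `x`.
-/
lemma IsClosedProperConvex.mem_subdifferential_of_mem_argmin_zObjective
    (hθ : IsClosedProperConvex θ) {w : X} {y : Y} {z₀ x z : X}
    (hz : z ∈ argmin (zObjective θ Q c A σ ρ w y z₀ x)) :
    x + σ • relaxedResidual Q c A ρ w y z₀ z ∈ subdifferential θ (-z) :=
  neg_mem_subdifferential_comp_neg_iff.1
    (neg_gradient_mem_subdifferential_of_mem_argmin hθ.comp_neg.2.1 hθ.comp_neg.2.2
      (isIsotropicQuadratic_zObjective Q c A σ ρ w y z₀ x) hz)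

lemma IsClosedProperConvex.exists_isGenerated (hθ : IsClosedProperConvex θ)
    (hA : Function.Surjective A) (hσ : 0 < σ) {z₀ : X} (x₀ : X) (hz₀ : -z₀ ∈ dom θ) :
    ∃ (w : ℕ → X) (y : ℕ → Y) (z x : ℕ → X), z 0 = z₀ ∧ x 0 = x₀ ∧
      IsGenerated θ Q c A b σ ρ w y z x := by
  have hy : ∀ p : X × X, ∃ y : Y, -p.1 ∈ dom θ →
      y ∈ argmin (fun y' => augLagrangian θ Q c A b σ p.2 y' p.1 p.2) := fun p => by
    by_cases h : -p.1 ∈ dom θ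
    · obtain ⟨y, hy, -⟩ := existsUnique_mem_argmin_augLagrangian (Q := Q) (c := c) (b := b)
        hθ.2.1 hA hσ p.2 p.1 p.2 h
      exact ⟨y, fun _ => hy⟩
    -- A default value outside the domain makes the step total; `hdom` shows that it is never used.
    · exact ⟨0, fun h' => absurd h' h⟩
  choose yNext hyNext using hy
  choose zNext hzNext _ using fun p : X × X =>
    hθ.existsUnique_mem_argmin_zObjective (Q := Q) (c := c) (A := A) (ρ := ρ) hσ p.2 (yNext p)
      p.1 p.2
  obtain ⟨s, hs₀, hs⟩ : ∃ s : ℕ → X × X, s 0 = (z₀, x₀) ∧ ∀ k, s (k + 1) =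
      (zNext (s k),
        (s k).2 + σ • relaxedResidual Q c A ρ (s k).2 (yNext (s k)) (s k).1 (zNext (s k))) :=
    ⟨fun k => (fun p : X × X => (zNext p,
      p.2 + σ • relaxedResidual Q c A ρ p.2 (yNext p) p.1 (zNext p)))^[k] (z₀, x₀), rfl,
      fun k => Function.iterate_succ_apply' _ k _⟩
  have hdom : ∀ k, -(s k).1 ∈ dom θ := by
    rintro (_ | k)
    · rwa [hs₀]
    · rw [hs]
      exact hθ.2.1.lt_top_of_mem_subdifferential
        (hθ.mem_subdifferential_of_mem_argmin_zObjective (hzNext (s k)))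
  -- `w` and `y` lag one index behind; truncated subtraction only affects their irrelevant values at
  -- `0`.
  refine ⟨fun k => (s (k - 1)).2, fun k => yNext (s (k - 1)), fun k => (s k).1,
    fun k => (s k).2, by simp only [hs₀], by simp only [hs₀], by simpa only [hs₀] using hz₀, fun k => ?_⟩
  simp only [Nat.add_sub_cancel, hs]
  exact ⟨trivial, hyNext _ (hdom k), hzNext (s k), trivial⟩

/-- One step of the relaxed three-operator splitting is Fejér monotone: `a`, `v`, `d` are the
differences of the iterates to a solution. -/
lemma norm_add_smul_sub_sq_le (hQ : Q.IsPositive) (hσ : 0 < σ) (hρ : 0 < ρ) {a v d : X}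
    (had : 0 ≤ inner ℝ a (d - a)) (hv : inner ℝ v (v - (2 : ℝ) • a + d + σ • Q a) = (0 : ℝ)) :
    ‖d + ρ • (v - a)‖ ^ 2 ≤
      ‖d‖ ^ 2 - ρ * ((4 - σ * lambdaMax Q) / 2 - ρ) * ‖v - a‖ ^ 2 := by
  -- Positivity of `Q` at `a + v`, written so that `⟨v, Q a⟩ ≥ -(λ_max / 4) ‖v - a‖²` results.
  have hpos := hQ.inner_nonneg_right ((2 : ℝ) • a + (v - a))
  have hmax := inner_le_lambdaMax Q (v - a)
  have hsymm : inner ℝ a (Q (v - a)) = inner ℝ (v - a) (Q a) := by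
    rw [← hQ.isSymmetric, real_inner_comm]
  have hq : 0 ≤ 4 * inner ℝ v (Q a) + lambdaMax Q * ‖v - a‖ ^ 2 := by
    have e : inner ℝ v (Q a) = inner ℝ a (Q a) + inner ℝ (v - a) (Q a) := by
      rw [← inner_add_left, add_sub_cancel]
    simp only [map_add, map_smul, inner_add_left _ (v - a), inner_add_right _ _ (Q (v - a)),
      real_inner_smul_left, real_inner_smul_right, hsymm] at hpos
    linarith
  have hq' := mul_nonneg hσ.le hq
  have hn : ‖v - a‖ ^ 2 = inner ℝ v v - 2 * inner ℝ v a + inner ℝ a a := by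
    rw [norm_sub_sq_real, ← real_inner_self_eq_norm_sq, ← real_inner_self_eq_norm_sq]
  -- `hv` evaluates `⟨v, d⟩` and `had` gives `⟨a, d⟩ ≥ ‖a‖²`; the difference is at most `-‖v - a‖² -
  -- σ ⟨v, Q a⟩`.
  have hinner : inner ℝ d (v - a) ≤ -(1 - σ * lambdaMax Q / 4) * ‖v - a‖ ^ 2 := by
    simp only [inner_add_right, inner_sub_right, real_inner_smul_right] at had hv ⊢
    rw [real_inner_comm v d, real_inner_comm a d]
    nlinarith
  rw [norm_add_sq_real, real_inner_smul_right, norm_smul, mul_pow, Real.norm_eq_abs, sq_abs]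
  have := mul_le_mul_of_nonneg_left hinner hρ.le
  linarith

end Algorithm

/-! ### Fejér monotonicity and convergence -/

section Convergence

variable {X Y : Type*}
  [NormedAddCommGroup X] [InnerProductSpace ℝ X] [FiniteDimensional ℝ X]
  [NormedAddCommGroup Y] [InnerProductSpace ℝ Y] [FiniteDimensional ℝ Y]
  {θ : X → EReal} {Q : X →ₗ[ℝ] X} {c : X} {A : X →ₗ[ℝ] Y} {b : Y} {σ ρ : ℝ}

lemma IsGenerated.neg_mem_dom (hθ : IsClosedProperConvex θ) {w : ℕ → X} {y : ℕ → Y}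
    {z x : ℕ → X} (h : IsGenerated θ Q c A b σ ρ w y z x) (k : ℕ) : -z k ∈ dom θ := by
  cases k with
  | zero => exact h.1
  | succ k =>
    exact hθ.2.1.lt_top_of_mem_subdifferential
      (hθ.mem_subdifferential_of_mem_argmin_zObjective (h.2 k).2.2.1)

lemma IsGenerated.mem_subdifferential (hθ : IsClosedProperConvex θ) {w : ℕ → X} {y : ℕ → Y}
    {z x : ℕ → X} (h : IsGenerated θ Q c A b σ ρ w y z x) (k : ℕ) :
    x (k + 1) ∈ subdifferential θ (-z (k + 1)) := by
  rw [(h.2 k).2.2.2]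
  exact hθ.mem_subdifferential_of_mem_argmin_zObjective (h.2 k).2.2.1

lemma IsGenerated.map_trialPoint_eq (hθ : IsClosedProperConvex θ) (hσ : 0 < σ) {w : ℕ → X}
    {y : ℕ → Y} {z x : ℕ → X} (h : IsGenerated θ Q c A b σ ρ w y z x) (k : ℕ) :
    A (trialPoint Q c A σ (x k) (y (k + 1)) (z k) (x k)) = b := by
  have := (mem_argmin_augLagrangian_iff hθ.2.1 hσ (h.neg_mem_dom hθ k)).1 (h.2 k).2.1
  rwa [(h.2 k).1] at this

/-- The new `z` cancels from `x - σ z`, which exposes the splitting iteration. -/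
lemma IsGenerated.sub_smul_succ {w : ℕ → X} {y : ℕ → Y} {z x : ℕ → X}
    (h : IsGenerated θ Q c A b σ ρ w y z x) (k : ℕ) :
    x (k + 1) - σ • z (k + 1) = x k - σ • z k +
      ρ • (trialPoint Q c A σ (x k) (y (k + 1)) (z k) (x k) - x k) := by
  rw [(h.2 k).2.2.2, (h.2 k).1, relaxedResidual, trialPoint]
  module

/-- Fejér monotonicity of the governing sequence `x - σ z` with respect to the KKT points. -/
lemma IsKKT.norm_sub_sq_le (hθ : IsProper θ) (hQ : Q.IsPositive) (hσ : 0 < σ) (hρ : 0 < ρ)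
    {w' z' x' x z : X} {y' y : Y} (h : IsKKT θ Q c A b w' y' z' x')
    (hx : x ∈ subdifferential θ (-z)) (hy : A (trialPoint Q c A σ x y z x) = b) :
    ‖x - x'‖ ≤ ‖x - σ • z - (x' - σ • z')‖ ∧
    ‖x - σ • z + ρ • (trialPoint Q c A σ x y z x - x) - (x' - σ • z')‖ ^ 2 ≤
      ‖x - σ • z - (x' - σ • z')‖ ^ 2 -
        ρ * ((4 - σ * lambdaMax Q) / 2 - ρ) * ‖trialPoint Q c A σ x y z x - x‖ ^ 2 := by
  obtain ⟨hw, hAx, hsub, hd⟩ := h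
  set u := trialPoint Q c A σ x y z x with hu
  set d := x - σ • z - (x' - σ • z') with hd_def
  have had : 0 ≤ inner ℝ (x - x') (d - (x - x')) := by
    have e : d - (x - x') = σ • (-z - -z') := by
      rw [hd_def]
      module
    rw [e, real_inner_smul_right]
    exact mul_nonneg hσ.le (hθ.subdifferential_monotone hx hsub)
  refine ⟨norm_le_of_inner_sub_nonneg had, ?_⟩
  -- The right factor lies in `range A^*`, while `u - x'` lies in `ker A`.
  have hv : inner ℝ (u - x') ((u - x') - (2 : ℝ) • (x - x') + d + σ • Q (x - x')) = (0 : ℝ) := by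
    have e : (u - x') - (2 : ℝ) • (x - x') + d + σ • Q (x - x') =
        σ • LinearMap.adjoint A (y - y') := by
      have hc : c = LinearMap.adjoint A y' + z' - Q x' := by
        rw [← hw, ← sub_eq_zero, ← neg_eq_zero, ← hd]
        abel
      rw [hd_def, hu, trialPoint, hc, map_sub, map_sub]
      module
    rw [e, real_inner_smul_right, LinearMap.adjoint_inner_right, map_sub, hy,
      sub_eq_zero.1 hAx, sub_self, inner_zero_left, mul_zero]
  have key := norm_add_smul_sub_sq_le hQ hσ hρ had hv
  have e1 : u - x' - (x - x') = u - x := by abel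
  have e2 : d + ρ • (u - x) = x - σ • z + ρ • (u - x) - (x' - σ • z') := by
    rw [hd_def]
    abel
  rwa [e1, e2] at key

lemma tendsto_zero_of_le_sub {D e : ℕ → ℝ} {κ : ℝ} (hκ : 0 < κ) (hD : ∀ k, 0 ≤ D k)
    (he : ∀ k, 0 ≤ e k) (h : ∀ k, D (k + 1) ≤ D k - κ * e k) : Tendsto e atTop (𝓝 0) := by
  have hanti : Antitone D := antitone_nat_of_succ_le fun k =>
    (h k).trans (sub_le_self _ (mul_nonneg hκ.le (he k)))
  have hlim := tendsto_atTop_ciInf hanti ⟨0, by rintro _ ⟨k, rfl⟩; exact hD k⟩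
  have hdiff := ((hlim.sub (hlim.comp (tendsto_add_atTop_nat 1))).const_mul κ⁻¹)
  rw [sub_self, mul_zero] at hdiff
  refine squeeze_zero he (fun k => ?_) hdiff
  rw [le_inv_mul_iff₀ hκ]
  have := h k
  simp only [Function.comp_apply]
  linarith

/-- The iterates converge to a KKT point as soon as one exists. -/
lemma IsGenerated.tendsto_isKKT (hθ : IsClosedProperConvex θ) (hQ : Q.IsPositive)
    (hA : Function.Surjective A) (hσ : 0 < σ) (hρ : 0 < ρ)
    (hρQ : ρ < (4 - σ * lambdaMax Q) / 2) {w₀ z₀ x₀ : X} {y₀ : Y}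
    (hKKT : IsKKT θ Q c A b w₀ y₀ z₀ x₀) {w : ℕ → X} {y : ℕ → Y} {z x : ℕ → X}
    (h : IsGenerated θ Q c A b σ ρ w y z x) :
    ∃ (y' : Y) (z' x' : X), Tendsto w atTop (𝓝 x') ∧ Tendsto y atTop (𝓝 y') ∧
      Tendsto z atTop (𝓝 z') ∧ Tendsto x atTop (𝓝 x') ∧ IsKKT θ Q c A b x' y' z' x' := by
  have := FiniteDimensional.proper ℝ X
  obtain ⟨G, hG⟩ := exists_gram_inverse hA
  have hAc : Continuous A := A.continuous_of_finiteDimensional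
  have hA'c : Continuous (LinearMap.adjoint A) :=
    (LinearMap.adjoint A).continuous_of_finiteDimensional
  have hQc : Continuous Q := Q.continuous_of_finiteDimensional
  have hGc : Continuous G := G.continuous_of_finiteDimensional
  let Yf : X × X → Y := fun p => G (σ⁻¹ • (b - A p.1) - A (p.2 - Q p.1 - c))
  let U : X × X → X := fun p => trialPoint Q c A σ p.1 (Yf p) p.2 p.1
  have hYc : Continuous Yf := by fun_prop
  have hUc : Continuous U := by
    simp only [U, trialPoint]
    fun_prop
  have hAU : ∀ p, A (U p) = b := fun p => (map_trialPoint_eq_iff hσ hG).2 rfl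
  have hy : ∀ k, y (k + 1) = Yf (x k, z k) := fun k =>
    (map_trialPoint_eq_iff hσ hG).1 (h.map_trialPoint_eq hθ hσ k)
  -- The shift by one is needed because `x 0 ∈ ∂θ(-z 0)` is not assumed.
  set S : ℕ → X := fun k => x (k + 1) - σ • z (k + 1) with hS
  have hSsucc : ∀ k, S (k + 1) = S k + ρ • (U (x (k + 1), z (k + 1)) - x (k + 1)) := fun k => by
    have := h.sub_smul_succ (k + 1)
    rwa [hy (k + 1)] at this
  have hκ : 0 < ρ * ((4 - σ * lambdaMax Q) / 2 - ρ) := mul_pos hρ (sub_pos.2 hρQ)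
  have hfejer : ∀ {w' z' x' : X} {y' : Y}, IsKKT θ Q c A b w' y' z' x' → ∀ k,
      ‖x (k + 1) - x'‖ ≤ ‖S k - (x' - σ • z')‖ ∧ ‖S (k + 1) - (x' - σ • z')‖ ^ 2 ≤
        ‖S k - (x' - σ • z')‖ ^ 2 - ρ * ((4 - σ * lambdaMax Q) / 2 - ρ) *
          ‖U (x (k + 1), z (k + 1)) - x (k + 1)‖ ^ 2 := fun hK k => by
    rw [hSsucc]
    exact hK.norm_sub_sq_le hθ.2.1 hQ hσ hρ (h.mem_subdifferential hθ k)
      (hAU (x (k + 1), z (k + 1)))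
  have hanti : ∀ {w' z' x' : X} {y' : Y}, IsKKT θ Q c A b w' y' z' x' →
      Antitone fun k => ‖S k - (x' - σ • z')‖ := fun hK => antitone_nat_of_succ_le fun k =>
    (sq_le_sq₀ (norm_nonneg _) (norm_nonneg _)).1 (((hfejer hK k).2).trans
      (sub_le_self _ (mul_nonneg hκ.le (sq_nonneg _))))
  have hres : Tendsto (fun k => U (x (k + 1), z (k + 1)) - x (k + 1)) atTop (𝓝 0) := by
    have h1 := tendsto_zero_of_le_sub hκ (D := fun k => ‖S k - (x₀ - σ • z₀)‖ ^ 2)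
      (fun k => sq_nonneg _) (fun k => sq_nonneg _)
      fun k => (hfejer hKKT k).2
    rw [tendsto_zero_iff_norm_tendsto_zero]
    simpa using h1.sqrt
  set R := ‖S 0 - (x₀ - σ • z₀)‖ with hR
  have hbound : ∀ k, (S k, x (k + 1)) ∈
      Metric.closedBall (x₀ - σ • z₀) R ×ˢ Metric.closedBall x₀ R := fun k => by
    have h1 : ‖S k - (x₀ - σ • z₀)‖ ≤ R := hanti hKKT (Nat.zero_le k)
    exact ⟨mem_closedBall_iff_norm.2 h1,
      mem_closedBall_iff_norm.2 ((hfejer hKKT k).1.trans h1)⟩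
  obtain ⟨⟨s', x'⟩, -, φ, hφ, hlim⟩ := ((isCompact_closedBall _ _).prod
    (isCompact_closedBall _ _)).tendsto_subseq hbound
  have hSφ : Tendsto (fun k => S (φ k)) atTop (𝓝 s') := hlim.fst_nhds
  have hxφ : Tendsto (fun k => x (φ k + 1)) atTop (𝓝 x') := hlim.snd_nhds
  have hz : ∀ k, z (k + 1) = σ⁻¹ • (x (k + 1) - S k) := fun k => by
    rw [hS, sub_sub_cancel, inv_smul_smul₀ hσ.ne']
  set z' := σ⁻¹ • (x' - s') with hz'
  have hs' : s' = x' - σ • z' := by rw [hz', smul_inv_smul₀ hσ.ne', sub_sub_cancel]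
  have hzφ : Tendsto (fun k => z (φ k + 1)) atTop (𝓝 z') := by
    simp only [hz]
    exact (hxφ.sub hSφ).const_smul _
  -- Continuity of `U` and the vanishing residual make the cluster point fixed, which encodes both
  -- primal and dual feasibility.
  have hU : U (x', z') = x' := by
    have h1 := (hUc.tendsto (x', z')).comp (hxφ.prodMk_nhds hzφ)
    have h2 := tendsto_nhds_unique (h1.sub hxφ) (hres.comp hφ.tendsto_atTop)
    exact sub_eq_zero.1 h2
  have hK : IsKKT θ Q c A b x' (Yf (x', z')) z' x' := by
    refine ⟨rfl, ?_, ?_, ?_⟩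
    · rw [sub_eq_zero, ← hAU (x', z'), hU]
    · exact mem_subdifferential_of_tendsto hθ.1 hzφ.neg hxφ
        (Eventually.of_forall fun k => h.mem_subdifferential hθ (φ k))
    · have h1 : x' + σ • (LinearMap.adjoint A (Yf (x', z')) + z' - Q x' - c) = x' := hU
      exact (smul_eq_zero.1 (add_eq_left.1 h1)).resolve_left hσ.ne'
  -- The distance to this KKT point is antitone and tends to `0` along a subsequence, hence along
  -- the whole sequence.
  have hS' : Tendsto (fun k => ‖S k - (x' - σ • z')‖) atTop (𝓝 0) := by
    rw [tendsto_iff_tendsto_subseq_of_antitone (hanti hK) hφ.tendsto_atTop]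
    rw [← hs']
    exact tendsto_iff_norm_sub_tendsto_zero.1 hSφ
  have hx1 : Tendsto (fun k => x (k + 1)) atTop (𝓝 x') :=
    tendsto_iff_norm_sub_tendsto_zero.2
      (squeeze_zero (fun _ => norm_nonneg _) (fun k => (hfejer hK k).1) hS')
  have hz1 : Tendsto (fun k => z (k + 1)) atTop (𝓝 z') := by
    simp only [hz]
    refine (hx1.sub ?_).const_smul _
    rw [hs']
    exact tendsto_iff_norm_sub_tendsto_zero.2 hS'
  have hx : Tendsto x atTop (𝓝 x') := (tendsto_add_atTop_iff_nat 1).1 hx1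
  have hzt : Tendsto z atTop (𝓝 z') := (tendsto_add_atTop_iff_nat 1).1 hz1
  refine ⟨Yf (x', z'), z', x', ?_, ?_, hzt, hx, hK⟩
  · refine (tendsto_add_atTop_iff_nat 1).1 ?_
    simpa only [(h.2 _).1] using hx
  · refine (tendsto_add_atTop_iff_nat 1).1 ?_
    simp only [hy]
    exact (hYc.tendsto (x', z')).comp (hx.prodMk_nhds hzt)

end Convergence

end CQP

theorem theorem2 {X Y : Type*}
    [NormedAddCommGroup X] [InnerProductSpace ℝ X] [FiniteDimensional ℝ X]
    [NormedAddCommGroup Y] [InnerProductSpace ℝ Y] [FiniteDimensional ℝ Y]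
    (θ : X → EReal) (hθ : CQP.IsClosedProperConvex θ)
    (Q : X →ₗ[ℝ] X) (hQ : Q.IsPositive) (c : X) (A : X →ₗ[ℝ] Y) (b : Y)
    (hsol : (CQP.threeTermSolutions θ Q c A b).Nonempty)
    (hA : Function.Surjective A)
    (hri : ∃ x ∈ intrinsicInterior ℝ (CQP.dom (CQP.conjugate θ)), A x = b)
    (σ ρ : ℝ) (hσ : 0 < σ) (hσQ : σ * CQP.lambdaMax Q < 2)
    (hρ : 0 < ρ) (hρQ : ρ < (4 - σ * CQP.lambdaMax Q) / 2) :
    -- every subproblem has exactly one solution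
    (∀ w z x : X, -z ∈ CQP.dom θ →
      ∃! y : Y, y ∈ CQP.argmin (fun y' => CQP.augLagrangian θ Q c A b σ w y' z x)) ∧
    (∀ (w : X) (y : Y) (z₀ x : X),
      ∃! z : X, z ∈ CQP.argmin (CQP.zObjective θ Q c A σ ρ w y z₀ x)) ∧
    -- from every admissible starting point the algorithm generates infinite sequences
    (∀ z₀ x₀ : X, -z₀ ∈ CQP.dom θ →
      ∃ (w : ℕ → X) (y : ℕ → Y) (z x : ℕ → X), z 0 = z₀ ∧ x 0 = x₀ ∧
        CQP.IsGenerated θ Q c A b σ ρ w y z x) ∧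
    -- all generated sequences converge to solutions
    (∀ (w : ℕ → X) (y : ℕ → Y) (z x : ℕ → X), CQP.IsGenerated θ Q c A b σ ρ w y z x →
      ∃ (w' : X) (y' : Y) (z' x' : X),
        Tendsto (fun k => (w k, y k, z k)) atTop (𝓝 (w', y', z')) ∧
        Tendsto x atTop (𝓝 x') ∧
        (w', y', z') ∈ CQP.dualSolutions θ Q c A b ∧
        x' ∈ CQP.primalSolutions θ Q c A b ∧
        CQP.IsKKT θ Q c A b w' y' z' x') := by
  refine ⟨fun w z x hz => CQP.existsUnique_mem_argmin_augLagrangian hθ.2.1 hA hσ w z x hz,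
    fun w y z₀ x => hθ.existsUnique_mem_argmin_zObjective hσ w y z₀ x,
    fun z₀ x₀ hz₀ => hθ.exists_isGenerated hA hσ x₀ hz₀, fun w y z x h => ?_⟩
  obtain ⟨y₀, z₀, x₀, hKKT⟩ := CQP.exists_isKKT hθ hQ hsol hri
  obtain ⟨y', z', x', hw, hy, hz, hx, hK⟩ := h.tendsto_isKKT hθ hQ hA hσ hρ hρQ hKKT
  exact ⟨x', y', z', x', hw.prodMk_nhds (hy.prodMk_nhds hz), hx,
    hK.mem_dualSolutions hθ.2.1 hQ, hK.mem_primalSolutions hθ.2.1 hQ, hK⟩
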